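/- All digraphs are finite; two opposite arcs between the same pair of vertices (a digon) are allowed, but parallel arcs are not. The underlying multigraph of a digraph $D$ is obtained by forgetting the orientations of its arcs (a digon gives two parallel edges). A multigraph is $m$-edge-connected if it remains connected after the removal of any set of at most $m-1$ edges, and $D$ is called $m$-edge-connected if its underlying multigraph is. A digraph is $k$-arc-strong if it remains strongly connected after the removal of any set of at most $k-1$ arcs. Inverting a set $X\subseteq V(D)$ means reversing every arc of $D$ that has both endvertices in $X$; for a set $\mathcal X$ of subsets of $V(D)$, $\mathrm{Inv}(D;\mathcal X)$ is the digraph obtained by inverting the members of $\mathcal X$ one after another (the order is irrelevant). Let $\mathrm{inv}_k^{=2}(D)$ (respectively $\mathrm{inv}_k^{\le p}(D)$) denote the minimum size of a set $\mathcal X$ of subsets of $V(D)$, each of size exactly $2$ (respectively at most $p$), such that $\mathrm{Inv}(D;\mathcal X)$ is $k$-arc-strong, with value $+\infty$ if there is no such set. **Lemma.** Let $k\ge 1$ and $p\ge 2$ be integers and let $D$ be a $2k$-edge-connected digraph. Then $$\mathrm{inv}_k^{=2}(D)\;\le\;(2k-1)(p-1)\,\mathrm{inv}_k^{\le p}(D).$$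 -/

import Mathlib

namespace Digraph

variable {V : Type*}

/-- The arc set of a digraph: `(u, v)` is the arc from `u` to `v`. -/
def arcs (D : Digraph V) : Set (V × V) := {a | D.Adj a.1 a.2}

/-- The digraph obtained by removing the arcs in `F`. -/
def removeArcs (D : Digraph V) (F : Set (V × V)) : Digraph V where
  Adj u v := D.Adj u v ∧ (u, v) ∉ F

/-- Strong connectivity: every vertex is reachable from every vertex by a directed path. -/
def IsStrong (D : Digraph V) : Prop :=
  ∀ u v : V, Relation.ReflTransGen D.Adj u v

/-- `D` is `k`-arc-strong if removing any set of fewer than `k` arcs leaves a strongly connected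
digraph. -/
def IsArcStrong (D : Digraph V) (k : ℕ) : Prop :=
  ∀ F : Set (V × V), F ⊆ D.arcs → F.encard < k → (D.removeArcs F).IsStrong

/-- The underlying multigraph: its edges are the arcs of `D` with the orientation forgotten, so
that a digon yields two parallel edges. -/
def underlyingMultigraph (D : Digraph V) : Graph V (V × V) where
  vertexSet := Set.univ
  IsLink a x y := D.Adj a.1 a.2 ∧ (a = (x, y) ∨ a = (y, x))
  isLink_symm _ _ := ⟨fun _ _ h => ⟨h.1, h.2.symm⟩⟩
  eq_or_eq_of_isLink_of_isLink := by
    rintro ⟨a, b⟩ x y v w ⟨-, h⟩ ⟨-, h'⟩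
    simp only [Prod.mk.injEq] at h h'
    grind
  left_mem_of_isLink _ _ _ _ := Set.mem_univ _

end Digraph

/-- A multigraph is `k`-edge-connected if, after the removal of any set of fewer than `k` edges, any
two vertices are joined by a path. -/
def Graph.IsEdgeConnected {α β : Type*} (G : Graph α β) (k : ℕ) : Prop :=
  ∀ F : Set β, F ⊆ G.edgeSet → F.encard < k →
    ∀ u ∈ G.vertexSet, ∀ v ∈ G.vertexSet, Relation.ReflTransGen (G.deleteEdges F).Adj u v

namespace Digraph

variable {V : Type*}

/-- A digraph is `k`-edge-connected if its underlying multigraph is. -/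
def IsEdgeConnected (D : Digraph V) (k : ℕ) : Prop :=
  D.underlyingMultigraph.IsEdgeConnected k

/-- Inversion of a vertex set `X`: all arcs with both endvertices in `X` are reversed, and the other
arcs are kept. -/
def inv (X : Finset V) (D : Digraph V) : Digraph V where
  Adj u v := ((u ∈ X ∧ v ∈ X) ∧ D.Adj v u) ∨ (¬ (u ∈ X ∧ v ∈ X) ∧ D.Adj u v)

/-- The order in which inversions are applied does not matter. -/
instance inv_leftCommutative :
    LeftCommutative (inv : Finset V → Digraph V → Digraph V) where
  left_comm X Y D := by
    ext u v
    simp only [inv]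
    tauto

/-- The digraph obtained from `D` by inverting the members of `𝒳` one after another. -/
def invAll (D : Digraph V) (𝒳 : Finset (Finset V)) : Digraph V :=
  𝒳.val.foldr inv D

/-- The minimum number of inversions of sets of size exactly `p` that make `D` `k`-arc-strong
(`⊤` if this is impossible). -/
noncomputable def invNumEq (k p : ℕ) (D : Digraph V) : ℕ∞ :=
  ⨅ 𝒳 ∈ {𝒳 : Finset (Finset V) | (∀ X ∈ 𝒳, X.card = p) ∧ (D.invAll 𝒳).IsArcStrong k},
    (𝒳.card : ℕ∞)

/-- The minimum number of inversions of sets of size at most `p` that make `D` `k`-arc-strong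
(`⊤` if this is impossible). -/
noncomputable def invNumLe (k p : ℕ) (D : Digraph V) : ℕ∞ :=
  ⨅ 𝒳 ∈ {𝒳 : Finset (Finset V) | (∀ X ∈ 𝒳, X.card ≤ p) ∧ (D.invAll 𝒳).IsArcStrong k},
    (𝒳.card : ℕ∞)

end Digraph

open Finset

/-! ### Rounding half-integral vectors under crossing supermodular bounds. -/

section Rounding

variable {V : Type*} [DecidableEq V]

/-! Inverting `𝒳` amounts to inverting the pairs lying in an odd number of its members. Among the
subfamilies of these pairs whose inversion is `k`-arc-strong, choose an inclusion-minimal `𝓕`. Every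
pair of `𝓕` lies in some `X ∈ 𝒳`, so it suffices that each `X` contains at most `(2k-1)(|X|-1)`
pairs of `𝓕`.

If some `X` contained more, the graph `𝓕` would have a `2k`-edge-connected subgraph induced on some
`Y ⊆ X`. By Nash-Williams' weak orientation theorem its edges have a `k`-arc-strong orientation.
Since the reverse orientation is also `k`-arc-strong, one of the two agrees with `D` on a given
edge. Imposing that one inside `Y` cancels at least one inversion and preserves `k`-arc-strength,
against minimality (`exists_ssubset_isArcStrong_invAll`).

The orientation theorem comes from half the degree vector: round it to prescribed in-degrees, then
realize these by Hall's theorem. -/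

theorem exists_pair_of_odd_of_crossing {Y : Finset V} {p : Finset V → ℤ} {M : V → ℤ}
    (hp : ∀ A ⊆ Y, ∀ B ⊆ Y, (A ∩ B).Nonempty → A ∪ B ≠ Y → p A + p B ≤ p (A ∩ B) + p (A ∪ B))
    (hM : ∀ S ⊆ Y, S.Nonempty → S ≠ Y → 2 * p S ≤ ∑ v ∈ S, M v)
    (hY : Even (∑ v ∈ Y, M v)) {s : V} (hs : s ∈ Y) (hodd : Odd (M s)) :
    ∃ t ∈ Y, t ≠ s ∧ Odd (M t) ∧
      ∀ S ⊆ Y, t ∈ S → s ∉ S → 2 * p S < ∑ v ∈ S, M v := by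
  classical
  by_contra! hcon
  -- Tight sets avoiding `s` uncross: the union of two that meet still avoids `s`, hence is not `Y`,
  -- and is tight. The maximal ones are therefore disjoint, each with even `M`-sum. If they covered
  -- every odd vertex other than `s`, the sum over `Y` would be odd.
  let tight : Finset (Finset V) := {S ∈ Y.powerset | s ∉ S ∧ ∑ v ∈ S, M v = 2 * p S}
  let mx : Finset (Finset V) := {S ∈ tight | Maximal (· ∈ tight) S}
  have htight : ∀ S, S ∈ tight ↔ S ⊆ Y ∧ s ∉ S ∧ ∑ v ∈ S, M v = 2 * p S := by
    intro S; simp [tight]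
  have hunion : ∀ A ∈ tight, ∀ B ∈ tight, (A ∩ B).Nonempty → A ∪ B ∈ tight := by
    intro A hA B hB hAB
    rw [htight] at hA hB ⊢
    obtain ⟨hAY, hsA, hAt⟩ := hA
    obtain ⟨hBY, hsB, hBt⟩ := hB
    have hsU : s ∉ A ∪ B := by simp [hsA, hsB]
    have hne : A ∪ B ≠ Y := fun h => hsU (h ▸ hs)
    have hne' : A ∩ B ≠ Y := fun h => hsA (Finset.mem_inter.1 (h ▸ hs)).1
    have hUY := union_subset hAY hBY
    have h1 := hp A hAY B hBY hAB hne
    have h2 := hM (A ∩ B) (inter_subset_left.trans hAY) hAB hne'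
    have h3 := hM (A ∪ B) hUY (hAB.mono (inter_subset_left.trans subset_union_left)) hne
    have h4 := Finset.sum_union_inter (s₁ := A) (s₂ := B) (f := M)
    exact ⟨hUY, hsU, by linarith⟩
  have hdisj : (mx : Set (Finset V)).PairwiseDisjoint id := by
    intro A hA B hB hAB
    simp only [mx, coe_filter, Set.mem_ofPred_eq] at hA hB
    by_contra hnd
    rw [Function.onFun, id, id, Finset.not_disjoint_iff_nonempty_inter] at hnd
    have hU := hunion A hA.1 B hB.1 hnd
    apply hAB
    have h1 : A = A ∪ B := le_antisymm subset_union_left (hA.2.2 hU subset_union_left)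
    have h2 : B = A ∪ B := le_antisymm subset_union_right (hB.2.2 hU subset_union_right)
    exact h1.trans h2.symm
  let U := mx.biUnion id
  have hUY : U ⊆ Y.erase s := by
    intro v hv
    obtain ⟨A, hA, hvA⟩ := Finset.mem_biUnion.1 hv
    obtain ⟨hAY, hsA, -⟩ := (htight A).1 (Finset.mem_filter.1 hA).1
    exact Finset.mem_erase.2 ⟨fun h => hsA (h ▸ hvA), hAY hvA⟩
  have hUeven : Even (∑ v ∈ U, M v) := by
    rw [Finset.sum_biUnion hdisj]
    refine Finset.even_sum _ fun A hA => ?_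
    obtain ⟨-, -, h⟩ := (htight A).1 (Finset.mem_filter.1 hA).1
    exact ⟨p A, by simp only [id]; omega⟩
  have hrest : Even (∑ v ∈ Y.erase s \ U, M v) := by
    refine Finset.even_sum _ fun v hv => ?_
    obtain ⟨hv, hvU⟩ := Finset.mem_sdiff.1 hv
    obtain ⟨hvs, hvY⟩ := Finset.mem_erase.1 hv
    by_contra hvo
    obtain ⟨S, hSY, hvS, hsS, hS⟩ := hcon v hvY hvs (Int.not_even_iff_odd.1 hvo)
    have hSt : S ∈ tight := (htight S).2
      ⟨hSY, hsS, le_antisymm hS (hM S hSY ⟨v, hvS⟩ fun h => hsS (h ▸ hs))⟩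
    obtain ⟨A, hSA, hA⟩ := tight.exists_le_maximal hSt
    exact hvU (Finset.mem_biUnion.2 ⟨A, Finset.mem_filter.2 ⟨hA.1, hA⟩, hSA hvS⟩)
  rw [← Finset.add_sum_erase _ _ hs, ← Finset.sum_sdiff hUY] at hY
  exact (Int.not_even_iff_odd.2 (hodd.add_even (hrest.add hUeven))) hY

/-- Here `M / 2` is the half-integral vector. Moving one half from an odd `t` to an odd `s` lowers
only the sets containing `t` but not `s`; `t` is chosen so that none of these is tight. Each move
removes two odd entries. -/
theorem exists_integral_of_half_integral {Y : Finset V} {p : Finset V → ℤ} {N : ℤ}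
    (hp : ∀ A ⊆ Y, ∀ B ⊆ Y, (A ∩ B).Nonempty → A ∪ B ≠ Y → p A + p B ≤ p (A ∩ B) + p (A ∪ B))
    (M : V → ℤ) (hM : ∀ S ⊆ Y, S.Nonempty → S ≠ Y → 2 * p S ≤ ∑ v ∈ S, M v)
    (hY : ∑ v ∈ Y, M v = 2 * N) :
    ∃ m : V → ℤ, (∀ S ⊆ Y, S.Nonempty → S ≠ Y → p S ≤ ∑ v ∈ S, m v) ∧ ∑ v ∈ Y, m v = N := by
  classical
  induction hn : #{v ∈ Y | Odd (M v)} using Nat.strong_induction_on generalizing M with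
  | _ n ih =>
  by_cases hT : ∃ s ∈ Y, Odd (M s)
  · obtain ⟨s, hs, hodd⟩ := hT
    obtain ⟨t, ht, hts, htodd, hst⟩ :=
      exists_pair_of_odd_of_crossing hp hM ⟨N, by omega⟩ hs hodd
    let M' : V → ℤ := fun v => M v + ((if v = s then 1 else 0) - (if v = t then 1 else 0))
    have hsum : ∀ S : Finset V, ∑ v ∈ S, M' v =
        ∑ v ∈ S, M v + ((if s ∈ S then 1 else 0) - (if t ∈ S then 1 else 0)) := by
      intro S
      simp only [M', Finset.sum_add_distrib, Finset.sum_sub_distrib, Finset.sum_ite_eq']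
    refine ih _ ?_ M' ?_ ?_ rfl
    · rw [← hn]
      apply Finset.card_lt_card
      rw [Finset.ssubset_iff_of_subset]
      · refine ⟨s, by simp [hs, hodd], ?_⟩
        simp only [mem_filter, not_and, M', if_neg hts.symm, if_true, Int.not_odd_iff_even]
        intro _
        simpa using hodd.add_odd odd_one
      · intro v hv
        simp only [mem_filter, M'] at hv ⊢
        refine ⟨hv.1, ?_⟩
        by_cases h1 : v = s
        · exact h1 ▸ hodd
        by_cases h2 : v = t
        · exact h2 ▸ htodd
        simpa [h1, h2] using hv.2
    · intro S hSY hS hSne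
      rw [hsum]
      have h1 := hM S hSY hS hSne
      have h2 := hst S hSY
      split_ifs with h3 h4 h4
      · omega
      · omega
      · have := h2 h4 h3; omega
      · omega
    · rw [hsum, if_pos hs, if_pos ht, hY]; ring
  · push Not at hT
    have heven : ∀ v ∈ Y, M v = 2 * (M v / 2) := fun v hv => by
      have := hT v hv
      rw [Int.not_odd_iff_even] at this
      obtain ⟨r, hr⟩ := this
      omega
    have hsum : ∀ S ⊆ Y, ∑ v ∈ S, M v = 2 * ∑ v ∈ S, M v / 2 := fun S hS => by
      rw [Finset.mul_sum]
      exact Finset.sum_congr rfl fun v hv => heven v (hS hv)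
    refine ⟨fun v => M v / 2, fun S hSY hS hSne => ?_, ?_⟩
    · have := hM S hSY hS hSne
      rw [hsum S hSY] at this
      dsimp only
      omega
    · have := hsum Y subset_rfl
      dsimp only
      omega

end Rounding

/-! ### Orientations with cut conditions, and highly connected subgraphs. -/

section Orientation

variable {V : Type*} [DecidableEq V]

/-- Hall's theorem, matching each edge to one of the `m v` slots at a vertex `v` of that edge: the
edges of a subfamily with union `S` all lie inside `S`, where there are `m(S)` slots. -/
theorem exists_head_of_card_le [Nonempty V] {Y : Finset V} {E : Finset (Finset V)} {m : V → ℤ}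
    (hEY : ∀ e ∈ E, e ⊆ Y) (hm : ∀ S ⊆ Y, (#{e ∈ E | e ⊆ S} : ℤ) ≤ ∑ v ∈ S, m v) :
    ∃ h : Finset V → V, (∀ e ∈ E, h e ∈ e) ∧
      ∀ S ⊆ Y, (#{e ∈ E | h e ∈ S} : ℤ) ≤ ∑ v ∈ S, m v := by
  classical
  have hm0 : ∀ v ∈ Y, 0 ≤ m v := fun v hv => by
    have := hm {v} (by simpa using hv)
    rw [Finset.sum_singleton] at this
    omega
  have hcard : ∀ S ⊆ Y, ((#(S.sigma fun v => range (m v).toNat) : ℕ) : ℤ) = ∑ v ∈ S, m v := by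
    intro S hS
    rw [Finset.card_sigma, Nat.cast_sum]
    refine Finset.sum_congr rfl fun v hv => ?_
    rw [Finset.card_range, Int.toNat_of_nonneg (hm0 v (hS hv))]
  let t : {e // e ∈ E} → Finset (Σ _ : V, ℕ) := fun e => e.1.sigma fun v => range (m v).toNat
  obtain ⟨f, hf, hft⟩ := (Finset.all_card_le_biUnion_card_iff_exists_injective t).1 (by
    intro s
    let S := s.biUnion fun e => e.1
    have hSY : S ⊆ Y := Finset.biUnion_subset.2 fun e _ => hEY e.1 e.2
    have h1 : s.biUnion t = S.sigma fun v => range (m v).toNat := by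
      ext ⟨v, j⟩
      simp only [t, S, mem_biUnion, mem_sigma]
      tauto
    have h2 : #s ≤ #{e ∈ E | e ⊆ S} := by
      rw [← Finset.card_map (Function.Embedding.subtype _)]
      refine Finset.card_le_card fun e he => ?_
      obtain ⟨e, hes, rfl⟩ := Finset.mem_map.1 he
      exact Finset.mem_filter.2 ⟨e.2, Finset.subset_biUnion_of_mem (fun e : {e // e ∈ E} => e.1) hes⟩
    rw [h1]
    have h3 := hcard S hSY
    have h4 := hm S hSY
    omega)
  let h : Finset V → V := fun e =>
    if he : e ∈ E then (f ⟨e, he⟩).1 else Classical.arbitrary V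
  have hh : ∀ e (he : e ∈ E), h e = (f ⟨e, he⟩).1 := fun e he => dif_pos he
  refine ⟨h, fun e he => ?_, fun S hS => ?_⟩
  · rw [hh e he]
    exact (Finset.mem_sigma.1 (hft ⟨e, he⟩)).1
  · rw [← hcard S hS, Nat.cast_le]
    refine Finset.card_le_card_of_injOn
      (fun e => if he : e ∈ E then f ⟨e, he⟩ else ⟨Classical.arbitrary V, 0⟩) ?_ ?_
    · intro e he
      obtain ⟨he, heS⟩ := Finset.mem_filter.1 he
      rw [hh e he] at heS
      simp only [dif_pos he]
      exact Finset.mem_sigma.2 ⟨heS, (Finset.mem_sigma.1 (hft ⟨e, he⟩)).2⟩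
    · intro a ha b hb hab
      have ha := (Finset.mem_filter.1 ha).1
      have hb := (Finset.mem_filter.1 hb).1
      simp only [dif_pos ha, dif_pos hb] at hab
      exact congrArg Subtype.val (hf hab)

theorem card_filter_subset_add_le (E : Finset (Finset V)) (A B : Finset V) :
    #{e ∈ E | e ⊆ A} + #{e ∈ E | e ⊆ B} ≤ #{e ∈ E | e ⊆ A ∩ B} + #{e ∈ E | e ⊆ A ∪ B} := by
  rw [← Finset.card_union_add_card_inter, add_comm]
  refine add_le_add (Finset.card_le_card fun e he => ?_) (Finset.card_le_card fun e he => ?_)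
  · simp only [mem_inter, mem_filter] at he ⊢
    exact ⟨he.1.1, subset_inter he.1.2 he.2.2⟩
  · simp only [mem_union, mem_filter] at he ⊢
    rcases he with he | he
    · exact ⟨he.1, he.2.trans subset_union_left⟩
    · exact ⟨he.1, he.2.trans subset_union_right⟩

theorem sum_degree_eq (E : Finset (Finset V)) (S : Finset V) :
    ∑ v ∈ S, #{e ∈ E | v ∈ e} = ∑ e ∈ E, #(S ∩ e) := by
  simp_rw [Finset.card_filter]
  rw [Finset.sum_comm]
  refine Finset.sum_congr rfl fun e _ => ?_
  rw [← Finset.card_filter, Finset.filter_mem_eq_inter]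

/-- The weak orientation theorem of Nash-Williams for simple graphs: `h` chooses the head of each
edge. -/
theorem exists_head_of_two_mul_le_cut [Nonempty V] {Y : Finset V} {E : Finset (Finset V)} {k : ℕ}
    (hE : ∀ e ∈ E, #e = 2) (hEY : ∀ e ∈ E, e ⊆ Y)
    (hcut : ∀ Z ⊆ Y, Z.Nonempty → Z ≠ Y → 2 * k ≤ #{e ∈ E | ¬ e ⊆ Z ∧ ¬ e ⊆ Y \ Z}) :
    ∃ h : Finset V → V, (∀ e ∈ E, h e ∈ e) ∧
      ∀ Z ⊆ Y, Z.Nonempty → Z ≠ Y → k ≤ #{e ∈ E | h e ∈ Z ∧ ¬ e ⊆ Z} := by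
  have hiY : {e ∈ E | e ⊆ Y} = E := Finset.filter_true_of_mem hEY
  -- With `i(S)` the number of edges inside `S`, the degree sum over `S` is at least `2 i(S)` plus
  -- the cut, hence at least `2 (i(S) + k)`.
  obtain ⟨m, hm, hmY⟩ := exists_integral_of_half_integral (Y := Y) (N := #E)
    (p := fun S => (#{e ∈ E | e ⊆ S} : ℤ) + k)
    (fun A _ B _ _ _ => by
      have := card_filter_subset_add_le E A B
      omega)
    (fun v => (#{e ∈ E | v ∈ e} : ℤ))
    (fun S hSY hS hSne => by
      have h1 := hcut S hSY hS hSne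
      have h2 : 2 * #{e ∈ E | e ⊆ S} + #{e ∈ E | ¬ e ⊆ S ∧ ¬ e ⊆ Y \ S} ≤
          ∑ v ∈ S, #{e ∈ E | v ∈ e} := by
        rw [sum_degree_eq, Finset.card_filter, Finset.card_filter, Finset.mul_sum,
          ← Finset.sum_add_distrib]
        refine Finset.sum_le_sum fun e he => ?_
        by_cases heS : e ⊆ S
        · simp [heS, Finset.inter_eq_right.2 heS, hE e he]
        by_cases heS' : e ⊆ Y \ S
        · simp [heS, heS']
        have : 0 < #(S ∩ e) := by
          rw [Finset.card_pos]
          by_contra hne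
          refine heS' (Finset.subset_sdiff.2 ⟨hEY e he, ?_⟩)
          rw [Finset.disjoint_iff_inter_eq_empty, Finset.inter_comm]
          exact Finset.not_nonempty_iff_eq_empty.1 hne
        simp only [heS, heS', if_false, not_false_iff, and_self, if_true]
        omega
      push_cast [← Nat.cast_sum]
      omega)
    (by
      have h1 : ∑ v ∈ Y, #{e ∈ E | v ∈ e} = 2 * #E := by
        rw [sum_degree_eq, Finset.sum_congr rfl fun e he => by
          rw [Finset.inter_eq_right.2 (hEY e he), hE e he], Finset.sum_const, smul_eq_mul, mul_comm]
      exact_mod_cast h1)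
  obtain ⟨h, hh, hhm⟩ := exists_head_of_card_le (m := m) hEY (fun S hS => by
    rcases S.eq_empty_or_nonempty with rfl | hne
    · rw [Finset.sum_empty, Finset.filter_false_of_mem fun e he => ?_]
      · simp
      · intro hc
        have := hE e he
        rw [Finset.subset_empty.1 hc] at this
        simp at this
    by_cases hSY : S = Y
    · rw [hSY, hmY, hiY]
    · have := hm S hS hne hSY
      omega)
  refine ⟨h, hh, fun Z hZY hZ hZne => ?_⟩
  -- Since `m(Y) = |E|`, the upper bound on heads in `Y \ Z` becomes the lower bound `m(Z) ≥ i(Z) +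
  -- k` on heads in `Z`; at most `i(Z)` of these come from edges inside `Z`.
  have h1 := hhm (Y \ Z) sdiff_subset
  have h2 := Finset.sum_sdiff (f := m) hZY
  have h3 := hm Z hZY hZ hZne
  have h4 : #{e ∈ E | h e ∈ Z} + #{e ∈ E | h e ∈ Y \ Z} = #E := by
    rw [← Finset.card_filter_add_card_filter_not (s := E) (fun e => h e ∈ Z)]
    congr 2
    refine Finset.filter_congr fun e he => ?_
    simp [hEY e he (hh e he)]
  have h5 : #{e ∈ E | h e ∈ Z} ≤ #{e ∈ E | e ⊆ Z} + #{e ∈ E | h e ∈ Z ∧ ¬ e ⊆ Z} := by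
    refine (Finset.card_le_card fun e he => ?_).trans (Finset.card_union_le _ _)
    simp only [mem_union, mem_filter] at he ⊢
    tauto
  omega

/-- A graph with more than `n * (#X - 1)` edges has an `(n + 1)`-edge-connected subgraph. -/
theorem exists_subset_of_mul_lt_card {E : Finset (Finset V)} {n : ℕ}
    (X : Finset V) (hX : n * (#X - 1) < #{e ∈ E | e ⊆ X}) :
    ∃ Y ⊆ X, {e ∈ E | e ⊆ Y}.Nonempty ∧ ∀ Z ⊆ Y, Z.Nonempty → Z ≠ Y →
      n < #{e ∈ {e ∈ E | e ⊆ Y} | ¬ e ⊆ Z ∧ ¬ e ⊆ Y \ Z} := by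
  induction X using Finset.strongInduction with
  | H X ih =>
  by_contra! hcon
  have hne : {e ∈ E | e ⊆ X}.Nonempty := Finset.card_pos.1 (by omega)
  obtain ⟨Z, hZX, hZ, hZne, hcut⟩ := hcon X subset_rfl hne
  have key : ∀ W ⊂ X, #{e ∈ E | e ⊆ W} ≤ n * (#W - 1) := by
    intro W hW
    by_contra! hlt
    obtain ⟨Y, hYW, hYne, hY⟩ := ih W hW hlt
    obtain ⟨Z, h1, h2, h3, h4⟩ := hcon Y (hYW.trans hW.1) hYne
    exact absurd (hY Z h1 h2 h3) (by omega)
  have h1 := key Z (hZX.ssubset_of_ne hZne)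
  have h2 := key (X \ Z) (Finset.sdiff_ssubset hZX hZ)
  have h3 : #{e ∈ E | e ⊆ X} ≤ #{e ∈ E | e ⊆ Z} + #{e ∈ E | e ⊆ X \ Z} +
      #{e ∈ {e ∈ E | e ⊆ X} | ¬ e ⊆ Z ∧ ¬ e ⊆ X \ Z} := by
    refine (Finset.card_le_card fun e he => ?_).trans
      ((Finset.card_union_le _ _).trans (add_le_add_left (Finset.card_union_le _ _) _))
    simp only [mem_union, mem_filter] at he ⊢
    tauto
  have h4 : #X = #Z + #(X \ Z) := by
    rw [add_comm, Finset.card_sdiff_add_card_eq_card hZX]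
  have h5 : 0 < #Z := hZ.card_pos
  have h6 : 0 < #(X \ Z) := by
    rw [Finset.card_pos, Finset.sdiff_nonempty]
    exact fun h => hZne (hZX.antisymm h)
  -- The two sides together leave room for exactly `n` more edges, which pays for the cut of at most
  -- `n`.
  have h7 : n * (#X - 1) = n * (#Z - 1) + n * (#(X \ Z) - 1) + n := by
    rw [← mul_add, ← Nat.mul_succ]
    congr 1
    omega
  omega

end Orientation

namespace Digraph

/-! ### Arc-strength through cuts, and inversion of families of pairs. -/

section ArcStrong

variable {V : Type*} [Fintype V] {D : Digraph V} {k : ℕ}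

theorem isArcStrong_iff_le_encard_outCut :
    D.IsArcStrong k ↔ ∀ S : Finset V, S.Nonempty → S ≠ univ →
      (k : ℕ∞) ≤ {a : V × V | D.Adj a.1 a.2 ∧ a.1 ∈ S ∧ a.2 ∉ S}.encard := by
  classical
  constructor
  · rintro h S ⟨u, hu⟩ hS
    by_contra! hlt
    obtain ⟨v, hv⟩ : ∃ v, v ∉ S := by simpa [Finset.eq_univ_iff_forall] using hS
    have hsub : {a : V × V | D.Adj a.1 a.2 ∧ a.1 ∈ S ∧ a.2 ∉ S} ⊆ D.arcs := fun a ha => ha.1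
    have hreach : ∀ w, Relation.ReflTransGen
        (D.removeArcs {a | D.Adj a.1 a.2 ∧ a.1 ∈ S ∧ a.2 ∉ S}).Adj u w → w ∈ S := by
      intro w hw
      induction hw with
      | refl => exact hu
      | tail _ hbc hb =>
        by_contra hc
        exact hbc.2 ⟨hbc.1, hb, hc⟩
    exact hv (hreach v (h _ hsub hlt u v))
  · intro h F _ hFk u v
    by_contra hv
    let S : Finset V := {w | Relation.ReflTransGen (D.removeArcs F).Adj u w}
    have hS : ∀ w, w ∈ S ↔ Relation.ReflTransGen (D.removeArcs F).Adj u w := by simp [S]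
    have hcut := h S ⟨u, (hS u).2 .refl⟩ fun hc => hv ((hS v).1 (hc ▸ mem_univ v))
    refine absurd (hcut.trans (Set.encard_le_encard ?_)) (not_le.2 hFk)
    rintro ⟨a, b⟩ ⟨hab, ha, hb⟩
    by_contra hF
    exact hb ((hS b).2 (((hS a).1 ha).tail ⟨hab, hF⟩))

end ArcStrong

variable {V : Type*} [DecidableEq V] {D : Digraph V} {k : ℕ}

theorem invAll_adj (𝒳 : Finset (Finset V)) (u v : V) :
    (D.invAll 𝒳).Adj u v ↔
      if Even #{X ∈ 𝒳 | u ∈ X ∧ v ∈ X} then D.Adj u v else D.Adj v u := by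
  have key : ∀ (s : Multiset (Finset V)) (u v : V), (s.foldr inv D).Adj u v ↔
      if Even (s.filter fun X => u ∈ X ∧ v ∈ X).card then D.Adj u v else D.Adj v u := by
    intro s
    induction s using Multiset.induction with
    | empty => simp
    | cons X s ih =>
      intro u v
      rw [Multiset.foldr_cons]
      simp only [inv, ih]
      have hcomm : s.filter (fun X => v ∈ X ∧ u ∈ X) = s.filter fun X => u ∈ X ∧ v ∈ X :=
        Multiset.filter_congr fun X _ => and_comm
      rw [hcomm]
      by_cases h : u ∈ X ∧ v ∈ X
      · rw [Multiset.filter_cons_of_pos (p := fun X => u ∈ X ∧ v ∈ X) _ h, Multiset.card_cons]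
        simp only [Nat.even_add_one, h, not_true_eq_false, false_and, or_false, true_and, and_self]
        split_ifs <;> rfl
      · rw [Multiset.filter_cons_of_neg (p := fun X => u ∈ X ∧ v ∈ X) _ h]
        simp only [h, not_false_iff, false_and, false_or, true_and]
  exact key 𝒳.val u v

theorem invAll_adj_of_card_eq_two {𝓕 : Finset (Finset V)} (h𝓕 : ∀ e ∈ 𝓕, #e = 2) (u v : V) :
    (D.invAll 𝓕).Adj u v ↔ if {u, v} ∈ 𝓕 then D.Adj v u else D.Adj u v := by
  rw [invAll_adj]
  by_cases huv : u = v
  · subst huv; simp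
  have hpair : ∀ e ∈ 𝓕, u ∈ e ∧ v ∈ e → {u, v} = e := fun e he h =>
    Finset.eq_of_subset_of_card_le (by simp [Finset.insert_subset_iff, h.1, h.2])
      (by rw [h𝓕 e he, Finset.card_pair huv])
  by_cases h : {u, v} ∈ 𝓕
  · have : {e ∈ 𝓕 | u ∈ e ∧ v ∈ e} = {{u, v}} := by
      ext e
      simp only [mem_filter, mem_singleton]
      exact ⟨fun he => (hpair e he.1 he.2).symm, fun he => by subst he; simp [h]⟩
    simp [this, h]
  · have : {e ∈ 𝓕 | u ∈ e ∧ v ∈ e} = ∅ :=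
      Finset.filter_eq_empty_iff.2 fun e he hc => h (hpair e he hc ▸ he)
    simp [this, h]

/-- The two-element sets contained in an odd number of members of `𝒳`. -/
def oddPairs (𝒳 : Finset (Finset V)) : Finset (Finset V) :=
  {e ∈ 𝒳.biUnion (powersetCard 2) | Odd #{X ∈ 𝒳 | e ⊆ X}}

theorem card_eq_two_of_mem_oddPairs {𝒳 : Finset (Finset V)} {e : Finset V}
    (he : e ∈ oddPairs 𝒳) : #e = 2 := by
  obtain ⟨X, -, hX⟩ := Finset.mem_biUnion.1 (Finset.mem_filter.1 he).1
  exact (Finset.mem_powersetCard.1 hX).2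

/-- Only the parity of the number of members containing both ends of an arc matters. -/
theorem invAll_oddPairs (𝒳 : Finset (Finset V)) : D.invAll (oddPairs 𝒳) = D.invAll 𝒳 := by
  ext u v
  rw [invAll_adj_of_card_eq_two fun e => card_eq_two_of_mem_oddPairs, invAll_adj]
  by_cases huv : u = v
  · subst huv; simp
  have hfilter : {X ∈ 𝒳 | {u, v} ⊆ X} = {X ∈ 𝒳 | u ∈ X ∧ v ∈ X} :=
    Finset.filter_congr fun X _ => by simp [Finset.insert_subset_iff]
  have hmem : {u, v} ∈ oddPairs 𝒳 ↔ ¬ Even #{X ∈ 𝒳 | u ∈ X ∧ v ∈ X} := by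
    rw [oddPairs, mem_filter, hfilter, Nat.not_even_iff_odd, and_iff_right_iff_imp]
    intro hodd
    obtain ⟨X, hX⟩ := Finset.card_pos.1 hodd.pos
    rw [← hfilter, mem_filter] at hX
    exact Finset.mem_biUnion.2
      ⟨X, hX.1, Finset.mem_powersetCard.2 ⟨hX.2, Finset.card_pair huv⟩⟩
  simp only [hmem, ite_not]

-- A cut that splits `Y` is supplied with `k` arcs by `E` alone. A cut that does not split `Y` is
-- crossed by no pair of `𝓡`, so it keeps the arcs it had.
open scoped Classical in
theorem isArcStrong_invAll_sdiff [Fintype V] {𝓕 E 𝓡 : Finset (Finset V)} {Y : Finset V}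
    (h𝓕 : ∀ e ∈ 𝓕, #e = 2) (hEY : ∀ e ∈ E, e ⊆ Y) (h𝓡 : 𝓡 ⊆ E)
    (hD : (D.invAll 𝓕).IsArcStrong k)
    (hcut : ∀ Z ⊆ Y, Z.Nonempty → Z ≠ Y → k ≤ #{e ∈ E |
      ∃ u v, e = {u, v} ∧ u ∈ Z ∧ v ∉ Z ∧ (D.invAll (𝓕 \ 𝓡)).Adj u v}) :
    (D.invAll (𝓕 \ 𝓡)).IsArcStrong k := by
  classical
  rw [isArcStrong_iff_le_encard_outCut] at hD ⊢
  intro S hS hSne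
  by_cases hsplit : (Y ∩ S).Nonempty ∧ Y ∩ S ≠ Y
  · refine (Nat.cast_le.2 (hcut (Y ∩ S) inter_subset_left hsplit.1 hsplit.2)).trans ?_
    rw [← Set.encard_coe_eq_coe_finsetCard]
    refine (Set.encard_le_encard ?_).trans
      (Set.encard_image_le (fun a : V × V => ({a.1, a.2} : Finset V)) _)
    intro e he
    obtain ⟨he, u, v, rfl, hu, hv, huv⟩ := Finset.mem_filter.1 he
    have hvY : v ∈ Y := hEY _ he (by simp)
    rw [Finset.mem_inter] at hu hv
    exact ⟨(u, v), ⟨huv, hu.2, fun h => hv ⟨hvY, h⟩⟩, rfl⟩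
  · refine (hD S hS hSne).trans (Set.encard_le_encard ?_)
    rintro ⟨u, v⟩ ⟨huv, hu, hv⟩
    refine ⟨?_, hu, hv⟩
    have hne : {u, v} ∉ 𝓡 := by
      intro h
      have h1 := hEY _ (h𝓡 h)
      have huY : u ∈ Y := h1 (by simp)
      have hvY : v ∈ Y := h1 (by simp)
      refine hsplit ⟨⟨u, mem_inter.2 ⟨huY, hu⟩⟩, fun h => hv ?_⟩
      rw [← h] at hvY
      exact (mem_inter.1 hvY).2
    rw [invAll_adj_of_card_eq_two h𝓕] at huv
    rw [invAll_adj_of_card_eq_two fun e he => h𝓕 e (sdiff_subset he)]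
    simpa [hne] using huv

/-! ### Minimal families of inverted pairs, and the bound. -/

theorem exists_ssubset_isArcStrong_invAll [Fintype V] {𝓕 : Finset (Finset V)} {Y : Finset V}
    (h𝓕 : ∀ e ∈ 𝓕, #e = 2) (hD : (D.invAll 𝓕).IsArcStrong k)
    (hor : ∀ u v, {u, v} ∈ 𝓕 → (D.Adj u v ↔ ¬ D.Adj v u))
    (hne : {e ∈ 𝓕 | e ⊆ Y}.Nonempty)
    (hcut : ∀ Z ⊆ Y, Z.Nonempty → Z ≠ Y →
      2 * k ≤ #{e ∈ {e ∈ 𝓕 | e ⊆ Y} | ¬ e ⊆ Z ∧ ¬ e ⊆ Y \ Z}) :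
    ∃ 𝓕' ⊂ 𝓕, (D.invAll 𝓕').IsArcStrong k := by
  classical
  set E : Finset (Finset V) := {e ∈ 𝓕 | e ⊆ Y} with hE
  have hE𝓕 : E ⊆ 𝓕 := filter_subset _ _
  have hEY : ∀ e ∈ E, e ⊆ Y := fun e he => (mem_filter.1 he).2
  obtain ⟨e₀, he₀⟩ := hne
  have : Nonempty V := by
    obtain ⟨v, -⟩ : e₀.Nonempty := Finset.card_pos.1 (by rw [h𝓕 _ (hE𝓕 he₀)]; norm_num)
    exact ⟨v⟩
  obtain ⟨h, hh, hhcut⟩ := exists_head_of_two_mul_le_cut (fun e he => h𝓕 e (hE𝓕 he)) hEY hcut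
  -- `R` collects the edges that `D` already orients towards `h`. Cancelling the inversions in `R`
  -- orients all of `E` by `h`; cancelling those in `E \ R` gives the reverse orientation. The
  -- choice depends on which of the two sets contains `e₀`, so that something is cancelled.
  let R : Finset (Finset V) := {e ∈ E | ∃ u v, e = {u, v} ∧ h e = v ∧ D.Adj u v}
  have hR : ∀ u v, {u, v} ∈ E → h {u, v} = v → ({u, v} ∈ R ↔ D.Adj u v) := by
    intro u v he hv
    have huv : u ≠ v := by
      rintro rfl
      simpa using h𝓕 _ (hE𝓕 he)
    simp only [R, mem_filter, he, true_and]
    refine ⟨?_, fun hD => ⟨u, v, rfl, hv, hD⟩⟩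
    rintro ⟨u', v', heq, hv', hD⟩
    obtain rfl : v = v' := hv.symm.trans hv'
    have hu : u ∈ ({u', v} : Finset V) := heq ▸ (by simp)
    obtain rfl : u = u' := by simpa [huv] using hu
    exact hD
  have hother : ∀ e ∈ E, ∀ Z : Finset V, h e ∈ Z → ¬ e ⊆ Z → ∃ u, u ∉ Z ∧ e = {u, h e} := by
    intro e he Z hZ heZ
    obtain ⟨u, hu, huZ⟩ := Finset.not_subset.1 heZ
    refine ⟨u, huZ, (Finset.eq_of_subset_of_card_le ?_ ?_).symm⟩
    · simp [Finset.insert_subset_iff, hu, hh e he]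
    · rw [h𝓕 e (hE𝓕 he), Finset.card_pair fun hc : u = h e => huZ (hc ▸ hZ)]
  have hadj : ∀ 𝓡 : Finset (Finset V), ∀ u v, (D.invAll (𝓕 \ 𝓡)).Adj u v ↔
      if {u, v} ∈ 𝓕 \ 𝓡 then D.Adj v u else D.Adj u v := fun 𝓡 =>
    invAll_adj_of_card_eq_two fun e he => h𝓕 e (sdiff_subset he)
  have hstrict : ∀ 𝓡 ⊆ E, 𝓡.Nonempty → 𝓕 \ 𝓡 ⊂ 𝓕 := fun 𝓡 h𝓡 h =>
    Finset.sdiff_ssubset (h𝓡.trans hE𝓕) h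
  by_cases hRne : e₀ ∈ R
  · refine ⟨𝓕 \ R, hstrict R (filter_subset _ _) ⟨e₀, hRne⟩,
      isArcStrong_invAll_sdiff h𝓕 hEY (filter_subset _ _) hD fun Z hZY hZ hZne => ?_⟩
    -- Arcs leaving `Z` inside `Y` are those entering `Y \ Z`.
    refine (hhcut (Y \ Z) sdiff_subset ?_ ?_).trans (Finset.card_le_card fun e he => ?_)
    · exact Finset.sdiff_nonempty.2 fun hc => hZne (hZY.antisymm hc)
    · intro hc
      obtain ⟨z, hz⟩ := hZ
      exact (mem_sdiff.1 (hc.symm.subset (hZY hz))).2 hz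
    obtain ⟨he, heZ, heZ'⟩ := Finset.mem_filter.1 he
    obtain ⟨u, hu, heq⟩ := hother e he _ heZ heZ'
    refine Finset.mem_filter.2 ⟨he, u, h e, heq, ?_, (mem_sdiff.1 heZ).2, ?_⟩
    · by_contra huZ
      exact hu (mem_sdiff.2 ⟨hEY e he (heq ▸ by simp), huZ⟩)
    · have h1 := hR u (h e) (heq ▸ he) (by rw [← heq])
      have h2 := hor u (h e) (heq ▸ hE𝓕 he)
      rw [hadj]
      rw [← heq] at h1 ⊢
      simp only [mem_sdiff, hE𝓕 he, true_and, h1]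
      split_ifs <;> tauto
  · refine ⟨𝓕 \ (E \ R), hstrict _ sdiff_subset ⟨e₀, mem_sdiff.2 ⟨he₀, hRne⟩⟩,
      isArcStrong_invAll_sdiff h𝓕 hEY sdiff_subset hD fun Z hZY hZ hZne => ?_⟩
    refine (hhcut Z hZY hZ hZne).trans (Finset.card_le_card fun e he => ?_)
    obtain ⟨he, heZ, heZ'⟩ := Finset.mem_filter.1 he
    obtain ⟨u, hu, heq⟩ := hother e he _ heZ heZ'
    refine Finset.mem_filter.2 ⟨he, h e, u, heq.trans (Finset.pair_comm _ _), heZ, hu, ?_⟩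
    have h1 := hR u (h e) (heq ▸ he) (by rw [← heq])
    have h2 := hor u (h e) (heq ▸ hE𝓕 he)
    rw [hadj, Finset.pair_comm]
    rw [← heq] at h1 ⊢
    simp only [mem_sdiff, hE𝓕 he, he, true_and, h1, not_not]
    split_ifs <;> tauto

theorem exists_card_le_isArcStrong_invAll [Fintype V] {p : ℕ} (hk : 1 ≤ k)
    {𝒳 : Finset (Finset V)} (h𝒳 : ∀ X ∈ 𝒳, #X ≤ p) (hD : (D.invAll 𝒳).IsArcStrong k) :
    ∃ 𝓕 : Finset (Finset V), (∀ e ∈ 𝓕, #e = 2) ∧ (D.invAll 𝓕).IsArcStrong k ∧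
      #𝓕 ≤ (2 * k - 1) * (p - 1) * #𝒳 := by
  classical
  have hmem : oddPairs 𝒳 ∈ ({𝓕 ∈ (oddPairs 𝒳).powerset | (D.invAll 𝓕).IsArcStrong k} :
      Finset (Finset (Finset V))) := by
    simpa [invAll_oddPairs] using hD
  obtain ⟨𝓕, -, hmin⟩ := Finset.exists_le_minimal _ hmem
  obtain ⟨h𝓕, hstrong⟩ := Finset.mem_filter.1 hmin.1
  rw [Finset.mem_powerset] at h𝓕
  have h𝓕2 : ∀ e ∈ 𝓕, #e = 2 := fun e he => card_eq_two_of_mem_oddPairs (h𝓕 he)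
  have hno : ∀ 𝓕' ⊂ 𝓕, ¬ (D.invAll 𝓕').IsArcStrong k := fun 𝓕' hss hs =>
    hss.2 (hmin.2 (Finset.mem_filter.2 ⟨Finset.mem_powerset.2 (hss.1.trans h𝓕), hs⟩) hss.1)
  -- Inverting a digon or a non-adjacent pair changes nothing, so minimality excludes both.
  have hor : ∀ u v, {u, v} ∈ 𝓕 → (D.Adj u v ↔ ¬ D.Adj v u) := by
    intro u v huv
    by_contra hsymm
    have hsymm : D.Adj u v ↔ D.Adj v u := by tauto
    refine hno _ (Finset.erase_ssubset huv) ?_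
    convert hstrong using 1
    ext a b
    rw [invAll_adj_of_card_eq_two h𝓕2,
      invAll_adj_of_card_eq_two fun e he => h𝓕2 e (Finset.mem_of_mem_erase he)]
    by_cases hab : ({a, b} : Finset V) = {u, v}
    · have : D.Adj a b ↔ D.Adj b a := by
        have h1 : a ∈ ({u, v} : Finset V) := hab ▸ (by simp)
        have h2 : b ∈ ({u, v} : Finset V) := hab ▸ (by simp)
        simp only [mem_insert, mem_singleton] at h1 h2
        rcases h1 with rfl | rfl <;> rcases h2 with rfl | rfl <;> tauto
      split_ifs <;> tauto
    · simp [Finset.mem_erase, hab]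
  have hbound : ∀ X ∈ 𝒳, #{e ∈ 𝓕 | e ⊆ X} ≤ (2 * k - 1) * (p - 1) := by
    intro X hX
    refine le_trans ?_ (Nat.mul_le_mul_left _ (Nat.sub_le_sub_right (h𝒳 X hX) 1))
    by_contra! hlt
    obtain ⟨Y, -, hYne, hY⟩ := exists_subset_of_mul_lt_card X hlt
    obtain ⟨𝓕', hss, hs⟩ := exists_ssubset_isArcStrong_invAll h𝓕2 hstrong hor hYne
      fun Z h1 h2 h3 => by have := hY Z h1 h2 h3; omega
    exact hno 𝓕' hss hs
  refine ⟨𝓕, h𝓕2, hstrong, ?_⟩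
  have hcover : 𝓕 ⊆ 𝒳.biUnion fun X => {e ∈ 𝓕 | e ⊆ X} := by
    intro e he
    obtain ⟨X, hX, heX⟩ := Finset.mem_biUnion.1 (Finset.mem_filter.1 (h𝓕 he)).1
    exact Finset.mem_biUnion.2
      ⟨X, hX, Finset.mem_filter.2 ⟨he, (Finset.mem_powersetCard.1 heX).1⟩⟩
  rw [mul_comm]
  exact (Finset.card_le_card hcover).trans (Finset.card_biUnion_le_card_mul _ _ _ hbound)

end Digraph

theorem mainTheorem4 {V : Type*} [Finite V] (D : Digraph V) (k p : ℕ) (hk : 1 ≤ k) (hp : 2 ≤ p)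
    (hD : D.IsEdgeConnected (2 * k)) :
    D.invNumEq k 2 ≤ (((2 * k - 1) * (p - 1) : ℕ) : ℕ∞) * D.invNumLe k p := by
  classical
  have := Fintype.ofFinite V
  -- A zero factor would not commute with the infimum of an empty family, as `0 * ⊤ = 0`.
  have hc : (((2 * k - 1) * (p - 1) : ℕ) : ℕ∞) ≠ 0 :=
    Nat.cast_ne_zero.2 (Nat.mul_ne_zero (by omega) (by omega))
  rw [Digraph.invNumLe, ENat.mul_iInf_of_ne hc]
  refine le_iInf fun 𝒳 => ?_
  rw [ENat.mul_iInf_of_ne hc]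
  refine le_iInf fun h𝒳 => ?_
  obtain ⟨𝓕, h𝓕, hstrong, hcard⟩ := Digraph.exists_card_le_isArcStrong_invAll hk h𝒳.1 h𝒳.2
  exact (iInf₂_le 𝓕 ⟨h𝓕, hstrong⟩).trans (by exact_mod_cast hcard)
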